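/- Let $A,A_1,\dots,A_l\in\mathbb R^{n\times n}$, $B,B_1,\dots,B_l\in\mathbb R^{n\times m}$, and for $\theta\in\mathbb R^l$ put $A(\theta)=A+\sum_{i=1}^l\theta_iA_i$, $B(\theta)=B+\sum_{i=1}^l\theta_iB_i$. Let $\tau,\gamma,\varepsilon>0$, $0<\eta<1$ and $\mu>\max_i\sum_{j=1}^n\bigl(|A_{ij}|+\sum_{k=1}^l|[A_k]_{ij}|\bigr)$. For $W\in\mathbb R^{n\times n}$ put $$M=[A(\theta)-\mu I,\;W,\;B(\theta)],\qquad N=[W,\;A(\theta)-\mu I,\;B(\theta)]^\intercal ,$$ and call $(\theta,W,Z)$ feasible if $$Z=\begin{bmatrix}0&M\\N&I_{2n+m}\end{bmatrix},\quad W\succeq\varepsilon I,\quad 0\le\theta_i\le1\ (i=1,\dots,l),\quad \sum_{i=1}^l\theta_i\ge1-\eta .$$ Write $\|Z\|_*$ for the nuclear norm and $\|Z\|_{F_{2n+m}}$ for the Ky Fan $(2n+m)$-norm (the sum of the $2n+m$ largest singular values). Consider the difference-of-convex problem of minimizing, over the feasible $(\theta,W,Z)$, $$F(\theta,W,Z)=\sum_{i=1}^l\frac{\log(1+\theta_i/\tau)}{\log(1+1/\tau)}+\gamma\bigl(\|Z\|_*-\|Z\|_{F_{2n+m}}\bigr).$$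 Let $(\theta^{(k)},W^{(k)},Z^{(k)})_{k\ge0}$ be any sequence generated by the following concave-convex procedure: $(\theta^{(0)},W^{(0)},Z^{(0)})$ is a feasible point, and for each $k\ge 0$, $(\theta^{(k+1)},W^{(k+1)},Z^{(k+1)})$ is an optimal solution of the convex program of minimizing $$\gamma\|Z\|_*+\sum_{i=1}^l\frac{\tau^{-1}}{\log(1+\tau^{-1})\,(1+\theta^{(k)}_i\tau^{-1})}\,\theta_i-\gamma\,\mathrm{tr}\bigl(U_1^{(k)\intercal}ZV_1^{(k)}\bigr)$$ over the feasible $(\theta,W,Z)$, where the columns of $U_1^{(k)}$ and $V_1^{(k)}$ are left and right singular vectors for the $2n+m$ largest singular values in some singular value decomposition of $Z^{(k)}$. Then: (i) $F(\theta^{(k+1)},W^{(k+1)},Z^{(k+1)})\le F(\theta^{(k)},W^{(k)},Z^{(k)})$ for all $k$; (ii) $\lim_{k\to\infty}\bigl(F(\theta^{(k+1)},W^{(k+1)},Z^{(k+1)})-F(\theta^{(k)},W^{(k)},Z^{(k)})\bigr)=0$ and $\lim_{k\to\infty}(\theta^{(k+1)}-\theta^{(k)})=0$. Moreover, the procedure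 converges to stationary points in the following sense. For every threshold $\xi>0$, the stopping test $\|\theta^{(k)}-\theta^{(k-1)}\|\le\xi$ is met at some $k\ge1$. Every limit point of the sequence $(\theta^{(k)},W^{(k)},Z^{(k)})$ is a stationary point. If the sequence $(W^{(k)})$ is bounded, the distance from $(\theta^{(k)},W^{(k)},Z^{(k)})$ to the set of stationary points tends to $0$. Here a stationary point is a feasible point satisfying the KKT conditions: there are subgradients $G\in\partial\|\cdot\|_*(Z)$ and $H\in\partial\|\cdot\|_{F_{2n+m}}(Z)$, and multipliers for all the constraints (of the right sign and complementary to the inequality constraints), for which the derivative of the Lagrangian, with $\gamma(G-H)$ taken as the derivative of $F$ in $Z$, vanishes. -/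

import Mathlib

open Filter Topology
open scoped Matrix

/-- The trace inner product `tr (Xᵀ Y)` of two real matrices of the same size. -/
def trInner {ι κ : Type*} [Fintype ι] [Fintype κ] (X Y : Matrix ι κ ℝ) : ℝ :=
  (Xᵀ * Y).trace

/-- The Ky Fan `r`-norm: the sum of the `r` largest singular values. (Mathlib's `singularValues`
is the decreasing sequence of singular values, indexed from `0` and continued by zeros.) -/
noncomputable def kyFanNorm {ι : Type*} [Fintype ι] [DecidableEq ι] (r : ℕ)
    (Z : Matrix ι ι ℝ) : ℝ :=
  ∑ i ∈ Finset.range r, (Matrix.toEuclideanLin Z).singularValues i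

/-- The nuclear norm: the sum of all singular values. -/
noncomputable def nuclearNorm {ι : Type*} [Fintype ι] [DecidableEq ι] (Z : Matrix ι ι ℝ) : ℝ :=
  ∑ i ∈ Finset.range (Fintype.card ι), (Matrix.toEuclideanLin Z).singularValues i

/-- The convex subdifferential of a function `f` on real matrices at `Z`. -/
def subdiff {ι : Type*} [Fintype ι] (f : Matrix ι ι ℝ → ℝ) (Z : Matrix ι ι ℝ) :
    Set (Matrix ι ι ℝ) :=
  {G | ∀ Z' : Matrix ι ι ℝ, f Z + trInner G (Z' - Z) ≤ f Z'}

/-- `Z = U₁ diag(d₁) V₁ᵀ + U₂ diag(d₂) V₂ᵀ` is a singular value decomposition of the square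
matrix `Z`, in which the block `(U₁, d₁, V₁)`, with columns indexed by `κ`, collects the largest
`card κ` singular values; among equal singular values any choice is allowed. -/
structure IsSplitSVD {ι κ κ' : Type*} [Fintype ι] [DecidableEq ι] [Fintype κ] [DecidableEq κ]
    [Fintype κ'] [DecidableEq κ'] (Z : Matrix ι ι ℝ)
    (U₁ : Matrix ι κ ℝ) (d₁ : κ → ℝ) (V₁ : Matrix ι κ ℝ)
    (U₂ : Matrix ι κ' ℝ) (d₂ : κ' → ℝ) (V₂ : Matrix ι κ' ℝ) : Prop where
  left_orth : (Matrix.fromCols U₁ U₂)ᵀ * Matrix.fromCols U₁ U₂ = 1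
  left_orth' : Matrix.fromCols U₁ U₂ * (Matrix.fromCols U₁ U₂)ᵀ = 1
  right_orth : (Matrix.fromCols V₁ V₂)ᵀ * Matrix.fromCols V₁ V₂ = 1
  right_orth' : Matrix.fromCols V₁ V₂ * (Matrix.fromCols V₁ V₂)ᵀ = 1
  nonneg₁ : ∀ i, 0 ≤ d₁ i
  nonneg₂ : ∀ j, 0 ≤ d₂ j
  largest : ∀ i j, d₂ j ≤ d₁ i
  eq : Z = U₁ * Matrix.diagonal d₁ * V₁ᵀ + U₂ * Matrix.diagonal d₂ * V₂ᵀ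

/-- Index set of cardinality `2n + m`. -/
abbrev MidIdx (n m : ℕ) := Fin n ⊕ (Fin n ⊕ Fin m)

/-- Index set of cardinality `3n + m`, of the rows and of the columns of `Z`. -/
abbrev ZIdx (n m : ℕ) := Fin n ⊕ MidIdx n m

/-- The data of the relaxed problem: the nominal pair `(A, B)`, the directions `(Aᵢ, Bᵢ)` of the
affine parameterization, and the scalar parameters. Pure data; the conditions on the scalars
are hypotheses of the theorem. -/
structure RelaxData (n m l : ℕ) where
  A : Matrix (Fin n) (Fin n) ℝ
  B : Matrix (Fin n) (Fin m) ℝ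
  Ap : Fin l → Matrix (Fin n) (Fin n) ℝ
  Bp : Fin l → Matrix (Fin n) (Fin m) ℝ
  μ : ℝ
  τ : ℝ
  γ : ℝ
  ε : ℝ
  η : ℝ

namespace RelaxData

variable {n m l : ℕ} (P : RelaxData n m l)

/-- `A(θ) = A + ∑ θᵢ Aᵢ`. -/
def Aθ (θ : EuclideanSpace ℝ (Fin l)) : Matrix (Fin n) (Fin n) ℝ :=
  P.A + ∑ i, θ i • P.Ap i

/-- `B(θ) = B + ∑ θᵢ Bᵢ`. -/
def Bθ (θ : EuclideanSpace ℝ (Fin l)) : Matrix (Fin n) (Fin m) ℝ :=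
  P.B + ∑ i, θ i • P.Bp i

/-- `M = [A(θ) - μ I, W, B(θ)]`. -/
def Mmat (θ : EuclideanSpace ℝ (Fin l)) (W : Matrix (Fin n) (Fin n) ℝ) :
    Matrix (Fin n) (MidIdx n m) ℝ :=
  Matrix.fromCols (P.Aθ θ - P.μ • 1) (Matrix.fromCols W (P.Bθ θ))

/-- `N = [W, A(θ) - μ I, B(θ)]ᵀ`. -/
def Nmat (θ : EuclideanSpace ℝ (Fin l)) (W : Matrix (Fin n) (Fin n) ℝ) :
    Matrix (MidIdx n m) (Fin n) ℝ :=
  (Matrix.fromCols W (Matrix.fromCols (P.Aθ θ - P.μ • 1) (P.Bθ θ)))ᵀ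

/-- The block matrix `[0, M; N, I]`, an affine function of `(θ, W)`. -/
def Zmat (θ : EuclideanSpace ℝ (Fin l)) (W : Matrix (Fin n) (Fin n) ℝ) :
    Matrix (ZIdx n m) (ZIdx n m) ℝ :=
  Matrix.fromBlocks 0 (P.Mmat θ W) (P.Nmat θ W) 1

/-- The constraints of the relaxed problem (`PosSemidef` includes symmetry). -/
structure Feasible (θ : EuclideanSpace ℝ (Fin l)) (W : Matrix (Fin n) (Fin n) ℝ)
    (Z : Matrix (ZIdx n m) (ZIdx n m) ℝ) : Prop where
  Z_eq : Z = P.Zmat θ W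
  W_ge : (W - P.ε • (1 : Matrix (Fin n) (Fin n) ℝ)).PosSemidef
  le_one : ∀ i, θ i ≤ 1
  nonneg : ∀ i, 0 ≤ θ i
  sum_ge : 1 - P.η ≤ ∑ i, θ i

/-- The objective
`F(θ, W, Z) = ∑ log(1 + θᵢ/τ) / log(1 + 1/τ) + γ (‖Z‖_* - ‖Z‖_{F_{2n+m}})`. -/
noncomputable def F (θ : EuclideanSpace ℝ (Fin l)) (_W : Matrix (Fin n) (Fin n) ℝ)
    (Z : Matrix (ZIdx n m) (ZIdx n m) ℝ) : ℝ :=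
  (∑ i, Real.log (1 + θ i / P.τ) / Real.log (1 + 1 / P.τ))
    + P.γ * (nuclearNorm Z - kyFanNorm (2 * n + m) Z)

/-- The weight `τ⁻¹ / (log(1 + τ⁻¹) (1 + t τ⁻¹))`, the derivative at `t` of
`t ↦ log(1 + t/τ) / log(1 + 1/τ)`. -/
noncomputable def weight (t : ℝ) : ℝ :=
  P.τ⁻¹ / (Real.log (1 + P.τ⁻¹) * (1 + t * P.τ⁻¹))

/-- The objective of the convex program built at the iterate `θk`, with singular vectors
`U₁, V₁` of the iterate `Zk`. -/
noncomputable def subObj (θk : EuclideanSpace ℝ (Fin l))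
    (U₁ V₁ : Matrix (ZIdx n m) (MidIdx n m) ℝ)
    (θ : EuclideanSpace ℝ (Fin l)) (Z : Matrix (ZIdx n m) (ZIdx n m) ℝ) : ℝ :=
  P.γ * nuclearNorm Z + (∑ i, P.weight (θk i) * θ i) - P.γ * (U₁ᵀ * Z * V₁).trace

/-- One iteration: pick a singular value decomposition of `Zk`, let `U₁, V₁` be the singular
vectors of the largest `2n + m` singular values, and take for `(θ', W', Z')` an optimal solution
of the resulting convex program. -/
def Step (θk : EuclideanSpace ℝ (Fin l)) (Zk : Matrix (ZIdx n m) (ZIdx n m) ℝ)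
    (θ' : EuclideanSpace ℝ (Fin l)) (W' : Matrix (Fin n) (Fin n) ℝ)
    (Z' : Matrix (ZIdx n m) (ZIdx n m) ℝ) : Prop :=
  ∃ (U₁ : Matrix (ZIdx n m) (MidIdx n m) ℝ) (d₁ : MidIdx n m → ℝ)
    (V₁ : Matrix (ZIdx n m) (MidIdx n m) ℝ)
    (U₂ : Matrix (ZIdx n m) (Fin n) ℝ) (d₂ : Fin n → ℝ) (V₂ : Matrix (ZIdx n m) (Fin n) ℝ),
    IsSplitSVD Zk U₁ d₁ V₁ U₂ d₂ V₂ ∧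
    P.Feasible θ' W' Z' ∧
    ∀ θ W Z, P.Feasible θ W Z → P.subObj θk U₁ V₁ θ' Z' ≤ P.subObj θk U₁ V₁ θ Z

/-- The sequence `(θ k, W k, Z k)` is generated by the concave-convex procedure. The initial
point is an optimal solution of the problem of minimizing the constant `1` under the
constraints, that is, any feasible point. -/
structure Generated (θ : ℕ → EuclideanSpace ℝ (Fin l)) (W : ℕ → Matrix (Fin n) (Fin n) ℝ)
    (Z : ℕ → Matrix (ZIdx n m) (ZIdx n m) ℝ) : Prop where
  init : P.Feasible (θ 0) (W 0) (Z 0)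
  step : ∀ k, P.Step (θ k) (Z k) (θ (k + 1)) (W (k + 1)) (Z (k + 1))

/-- Stationary (KKT) points of the relaxed difference-of-convex problem: feasible points with
multipliers `Y` (for `Z = Zmat θ W`), `S` (for `W ⪰ ε I`), `a` (for `θ ≥ 0`), `b` (for `θ ≤ 1`)
and `c` (for `∑ θᵢ ≥ 1 - η`), of the right sign and complementary to the constraints, and with
subgradients `G` and `H` of the nuclear norm and of the Ky Fan norm at `Z`, such that the
derivative of the Lagrangian vanishes in every direction `(dθ, dW, dZ)`, `dW` symmetric. -/
def IsStationary (θ : EuclideanSpace ℝ (Fin l)) (W : Matrix (Fin n) (Fin n) ℝ)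
    (Z : Matrix (ZIdx n m) (ZIdx n m) ℝ) : Prop :=
  P.Feasible θ W Z ∧
  ∃ G ∈ subdiff nuclearNorm Z, ∃ H ∈ subdiff (kyFanNorm (2 * n + m)) Z,
  ∃ (Y : Matrix (ZIdx n m) (ZIdx n m) ℝ) (S : Matrix (Fin n) (Fin n) ℝ)
    (a b : Fin l → ℝ) (c : ℝ),
    S.PosSemidef ∧ (∀ i, 0 ≤ a i) ∧ (∀ i, 0 ≤ b i) ∧ 0 ≤ c ∧
    trInner S (W - P.ε • (1 : Matrix (Fin n) (Fin n) ℝ)) = 0 ∧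
    (∀ i, a i * θ i = 0) ∧ (∀ i, b i * (1 - θ i) = 0) ∧
    c * ((∑ i, θ i) - (1 - P.η)) = 0 ∧
    ∀ (dθ : EuclideanSpace ℝ (Fin l)) (dW : Matrix (Fin n) (Fin n) ℝ)
      (dZ : Matrix (ZIdx n m) (ZIdx n m) ℝ), dW.IsSymm →
      (∑ i, P.weight (θ i) * dθ i) + P.γ * (trInner G dZ - trInner H dZ)
        + trInner Y (dZ - (P.Zmat (θ + dθ) (W + dW) - P.Zmat θ W))
        - trInner S dW - (∑ i, a i * dθ i) + (∑ i, b i * dθ i) - c * (∑ i, dθ i) = 0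

end RelaxData

/-!
The procedure is a majorization-minimization scheme. At the iterate `(θₖ, Zₖ)` the logarithmic
penalty is replaced by its tangent and the Ky Fan norm by its affine minorant with slope
`H = U₁ V₁ᵀ`. The latter is legitimate because `kyFanNorm r Z` is the maximum of `tr (Pᵀ Z Q)` over
pairs of orthonormal `r`-frames, attained at leading singular vectors
(`IsSplitSVD.trace_le`, `IsSplitSVD.trace_eq`); this also shows that the Ky Fan norms, the nuclear
norm among them, are convex, hence continuous. As the logarithm is uniformly strongly concave on
`[0, 1]`, one step lowers `F` by at least `κ ‖θₖ₊₁ - θₖ‖²` plus the amount by which the linearized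
objective decreases (`RelaxData.exists_F_le`). Since `F ≥ 0`, both amounts tend to zero.

Consequently each iterate is asymptotically optimal for its own convex program. Along an
ultrafilter on which the iterates converge, the bounded slopes `H` converge too, to a subgradient
of the Ky Fan norm at the limit, because the graph of the subdifferential is closed. The limit thus
solves the convex program linearized at itself with that slope
(`RelaxData.Generated.isStationary_of_tendsto`); convergence of the iterates `k + 1` along the
ultrafilter is not needed.

Such a point is a KKT point (`RelaxData.isStationary_of_forall_le`). No constraint qualification is
needed: separating the strict epigraph of the finite convex function `γ ‖·‖_* - γ ⟨H, ·⟩` from the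
set of feasible `Z` with the complementary levels yields a subgradient at `Z` whose pairing with
`Z(θ, W)`, plus the linear term in `θ`, is minimal over the feasible set. That is a linear program
in `θ` on a box cut by one half-space and a linear functional on a shifted semidefinite cone in
`W`, and the multipliers of both are explicit.
-/

/-! ### Singular value decompositions and the Ky Fan norms -/

/-- The singular value decomposition of a square matrix, with Mathlib's sorted singular values. The
left singular vectors of the nonzero singular values are the normalized images of the right ones,
the others an arbitrary completion. -/
theorem exists_orthonormalBasis_singularValues {ι : Type*} [Fintype ι] [DecidableEq ι]
    (Z : Matrix ι ι ℝ) :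
    ∃ u v : OrthonormalBasis (Fin (Fintype.card ι)) ℝ (EuclideanSpace ℝ ι),
      ∀ i, Matrix.toEuclideanLin Z (v i) =
        (Matrix.toEuclideanLin Z).singularValues i • u i := by
  set T := Matrix.toEuclideanLin Z with hT
  have hn : Module.finrank ℝ (EuclideanSpace ℝ ι) = Fintype.card ι := finrank_euclideanSpace
  set v := T.isSymmetric_adjoint_comp_self.eigenvectorBasis hn with hv
  have hinner : ∀ i j, inner ℝ (T (v i)) (T (v j)) =
      if i = j then T.singularValues i ^ 2 else 0 := by
    intro i j
    have h1 : inner ℝ (T (v i)) (T (v j)) = inner ℝ (v i) ((T.adjoint ∘ₗ T) (v j)) := by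
      rw [LinearMap.comp_apply, LinearMap.adjoint_inner_right]
    rw [h1, T.isSymmetric_adjoint_comp_self.apply_eigenvectorBasis hn j, inner_smul_right,
      v.inner_eq_ite, T.sq_singularValues_fin hn]
    split_ifs with h
    · subst h; simp
    · simp
  set s : Set (Fin (Fintype.card ι)) := {i | T.singularValues i ≠ 0} with hs
  have horth : Orthonormal ℝ
      (s.domRestrict fun i => (T.singularValues i)⁻¹ • T (v i)) := by
    rw [orthonormal_iff_ite]
    rintro ⟨i, hi⟩ ⟨j, hj⟩
    have hi' : T.singularValues i ≠ 0 := hi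
    simp only [Set.domRestrict_apply, inner_smul_left, inner_smul_right, hinner,
      Subtype.mk.injEq]
    split_ifs with h
    · subst h
      simp only [conj_trivial]
      field_simp
    · simp
  obtain ⟨u, hu⟩ := horth.exists_orthonormalBasis_extension_of_card_eq (by simp)
  refine ⟨u, v, fun i => ?_⟩
  by_cases hi : T.singularValues i = 0
  · have := hinner i i
    rw [if_pos rfl, hi, real_inner_self_eq_norm_sq] at this
    rw [hi, zero_smul, ← norm_eq_zero]
    simpa using this
  · rw [hu i hi, smul_smul, mul_inv_cancel₀ hi, one_smul]

/-- A matrix with orthonormal columns has rows of norm at most one. -/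
theorem sum_sq_row_le_one {ι κ : Type*} [Fintype ι] [Fintype κ] [DecidableEq κ]
    {X : Matrix ι κ ℝ} (hX : Xᵀ * X = 1) (i : ι) : ∑ j, X i j ^ 2 ≤ 1 := by
  have hE : (X * Xᵀ) * (X * Xᵀ) = X * Xᵀ := by
    rw [Matrix.mul_assoc, ← Matrix.mul_assoc Xᵀ, hX, Matrix.one_mul]
  have hii : (X * Xᵀ) i i = ∑ j, X i j ^ 2 := by
    simp [Matrix.mul_apply, sq]
  have hsym : ∀ k, (X * Xᵀ) k i = (X * Xᵀ) i k := fun k => by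
    simp [Matrix.mul_apply, mul_comm]
  have h1 : (X * Xᵀ) i i = ∑ k, (X * Xᵀ) i k ^ 2 := by
    conv_lhs => rw [← hE, Matrix.mul_apply]
    exact Finset.sum_congr rfl fun k _ => by rw [hsym, sq]
  have h2 : (X * Xᵀ) i i ^ 2 ≤ (X * Xᵀ) i i := by
    conv_rhs => rw [h1]
    exact Finset.single_le_sum (f := fun k => (X * Xᵀ) i k ^ 2) (fun k _ => sq_nonneg _)
      (Finset.mem_univ i)
  rw [← hii]
  nlinarith

theorem sum_sq_eq_card {ι κ : Type*} [Fintype ι] [Fintype κ] [DecidableEq κ]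
    {X : Matrix ι κ ℝ} (hX : Xᵀ * X = 1) : ∑ i, ∑ j, X i j ^ 2 = Fintype.card κ := by
  have : (Xᵀ * X).trace = Fintype.card κ := by rw [hX, Matrix.trace_one]
  rw [← this, Finset.sum_comm]
  simp [Matrix.trace, Matrix.mul_apply, sq]

/-- Weights of total mass at most `card κ`, none above one on the `card κ` largest coefficients and
all nonnegative on the others, are best spent as weight one on each of the largest. -/
theorem sum_mul_le_sum_of_le_one {κ κ' : Type*} [Fintype κ] [Fintype κ']
    {d₁ c₁ : κ → ℝ} {d₂ c₂ : κ' → ℝ} (hd₁ : ∀ i, 0 ≤ d₁ i) (hd₂ : ∀ j, 0 ≤ d₂ j)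
    (hd : ∀ i j, d₂ j ≤ d₁ i) (hc₁ : ∀ i, c₁ i ≤ 1) (hc₂ : ∀ j, 0 ≤ c₂ j)
    (hc : ∑ i, c₁ i + ∑ j, c₂ j ≤ Fintype.card κ) :
    ∑ i, d₁ i * c₁ i + ∑ j, d₂ j * c₂ j ≤ ∑ i, d₁ i := by
  -- a threshold separating the two families of weights
  obtain ⟨t, ht0, ht₁, ht₂⟩ : ∃ t : ℝ, 0 ≤ t ∧ (∀ i, t ≤ d₁ i) ∧ ∀ j, d₂ j ≤ t := by
    rcases isEmpty_or_nonempty κ' with h | h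
    · exact ⟨0, le_rfl, hd₁, fun j => (IsEmpty.false j).elim⟩
    · obtain ⟨j, hj⟩ := Finite.exists_max d₂
      exact ⟨d₂ j, hd₂ j, fun i => hd i j, hj⟩
  have h1 : ∑ i, t * (1 - c₁ i) ≤ ∑ i, d₁ i * (1 - c₁ i) :=
    Finset.sum_le_sum fun i _ => mul_le_mul_of_nonneg_right (ht₁ i) (by linarith [hc₁ i])
  have h2 : ∑ j, d₂ j * c₂ j ≤ ∑ j, t * c₂ j :=
    Finset.sum_le_sum fun j _ => mul_le_mul_of_nonneg_right (ht₂ j) (hc₂ j)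
  simp only [mul_sub, mul_one, Finset.sum_sub_distrib, ← Finset.mul_sum, Finset.sum_const,
    Finset.card_univ, nsmul_eq_mul] at h1 h2
  nlinarith [mul_le_mul_of_nonneg_left hc ht0]

namespace IsSplitSVD

variable {ι κ κ' : Type*} [Fintype ι] [DecidableEq ι] [Fintype κ] [DecidableEq κ]
    [Fintype κ'] [DecidableEq κ'] {Z : Matrix ι ι ℝ}
    {U₁ : Matrix ι κ ℝ} {d₁ : κ → ℝ} {V₁ : Matrix ι κ ℝ}
    {U₂ : Matrix ι κ' ℝ} {d₂ : κ' → ℝ} {V₂ : Matrix ι κ' ℝ}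

theorem eq_fromCols (h : IsSplitSVD Z U₁ d₁ V₁ U₂ d₂ V₂) :
    Z = Matrix.fromCols U₁ U₂ * Matrix.diagonal (Sum.elim d₁ d₂) *
      (Matrix.fromCols V₁ V₂)ᵀ := by
  rw [← Matrix.fromBlocks_diagonal, Matrix.transpose_fromCols, Matrix.fromCols_mul_fromBlocks,
    Matrix.fromCols_mul_fromRows]
  simpa using h.eq

theorem left_blocks (h : IsSplitSVD Z U₁ d₁ V₁ U₂ d₂ V₂) : U₁ᵀ * U₁ = 1 ∧ U₁ᵀ * U₂ = 0 := by
  have := h.left_orth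
  rw [Matrix.transpose_fromCols, Matrix.fromRows_mul_fromCols, ← Matrix.fromBlocks_one,
    Matrix.fromBlocks_inj] at this
  exact ⟨this.1, this.2.1⟩

theorem right_blocks (h : IsSplitSVD Z U₁ d₁ V₁ U₂ d₂ V₂) : V₁ᵀ * V₁ = 1 ∧ V₂ᵀ * V₁ = 0 := by
  have := h.right_orth
  rw [Matrix.transpose_fromCols, Matrix.fromRows_mul_fromCols, ← Matrix.fromBlocks_one,
    Matrix.fromBlocks_inj] at this
  exact ⟨this.1, this.2.2.1⟩

theorem trace_eq (h : IsSplitSVD Z U₁ d₁ V₁ U₂ d₂ V₂) :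
    (U₁ᵀ * Z * V₁).trace = ∑ i, d₁ i := by
  obtain ⟨hU, hU'⟩ := h.left_blocks
  obtain ⟨hV, hV'⟩ := h.right_blocks
  have : U₁ᵀ * Z * V₁ = Matrix.diagonal d₁ := by
    calc U₁ᵀ * Z * V₁ = (U₁ᵀ * U₁) * Matrix.diagonal d₁ * (V₁ᵀ * V₁)
          + (U₁ᵀ * U₂) * Matrix.diagonal d₂ * (V₂ᵀ * V₁) := by
            rw [h.eq]; simp only [Matrix.mul_add, Matrix.add_mul, Matrix.mul_assoc]
      _ = Matrix.diagonal d₁ := by rw [hU, hU', hV]; simp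
  rw [this, Matrix.trace_diagonal]

/-- Ky Fan's inequality: tested against orthonormal frames `P` and `Q`, a matrix gives at most
the sum of its largest singular values. -/
theorem trace_le (h : IsSplitSVD Z U₁ d₁ V₁ U₂ d₂ V₂) {P Q : Matrix ι κ ℝ}
    (hP : Pᵀ * P = 1) (hQ : Qᵀ * Q = 1) : (Pᵀ * Z * Q).trace ≤ ∑ i, d₁ i := by
  set U := Matrix.fromCols U₁ U₂ with hUdef
  set V := Matrix.fromCols V₁ V₂ with hVdef
  set d := Sum.elim d₁ d₂ with hd
  have hX : (Uᵀ * P)ᵀ * (Uᵀ * P) = 1 := by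
    rw [Matrix.transpose_mul, Matrix.transpose_transpose, Matrix.mul_assoc, ← Matrix.mul_assoc U,
      h.left_orth', Matrix.one_mul, hP]
  have hY : (Vᵀ * Q)ᵀ * (Vᵀ * Q) = 1 := by
    rw [Matrix.transpose_mul, Matrix.transpose_transpose, Matrix.mul_assoc, ← Matrix.mul_assoc V,
      h.right_orth', Matrix.one_mul, hQ]
  set X := Uᵀ * P
  set Y := Vᵀ * Q
  set c : κ ⊕ κ' → ℝ := fun i => (∑ j, X i j ^ 2 + ∑ j, Y i j ^ 2) / 2 with hc
  have hdnn : ∀ i, 0 ≤ d i := by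
    rintro (i | j)
    · exact h.nonneg₁ i
    · exact h.nonneg₂ j
  have htr : (Pᵀ * Z * Q).trace = ∑ i, d i * ∑ j, X i j * Y i j := by
    have : Pᵀ * Z * Q = Xᵀ * Matrix.diagonal d * Y := by
      rw [h.eq_fromCols]
      simp only [X, Y, Matrix.transpose_mul, Matrix.transpose_transpose, Matrix.mul_assoc,
        hUdef, hVdef, hd]
    rw [this]
    simp only [Matrix.trace, Matrix.diag, Matrix.mul_apply (M := Xᵀ * Matrix.diagonal d),
      Matrix.mul_diagonal, Matrix.transpose_apply, Finset.mul_sum]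
    rw [Finset.sum_comm]
    exact Finset.sum_congr rfl fun i _ => Finset.sum_congr rfl fun j _ => by ring
  have hle : ∑ i, d i * ∑ j, X i j * Y i j ≤ ∑ i, d i * c i := by
    refine Finset.sum_le_sum fun i _ => mul_le_mul_of_nonneg_left ?_ (hdnn i)
    simp only [hc]
    rw [← Finset.sum_add_distrib, Finset.sum_div]
    exact Finset.sum_le_sum fun j _ => by nlinarith [sq_nonneg (X i j - Y i j)]
  have hc1 : ∀ i, c i ≤ 1 := fun i => by
    have := sum_sq_row_le_one hX i
    have := sum_sq_row_le_one hY i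
    simp only [hc]; linarith
  have hc0 : ∀ i, 0 ≤ c i := fun i => by simp only [hc]; positivity
  have hcsum : ∑ i, c i = Fintype.card κ := by
    simp only [hc]
    rw [← Finset.sum_div, Finset.sum_add_distrib, sum_sq_eq_card hX, sum_sq_eq_card hY]
    ring
  rw [htr]
  refine hle.trans ?_
  rw [Fintype.sum_sum_type] at hcsum ⊢
  exact sum_mul_le_sum_of_le_one h.nonneg₁ h.nonneg₂ h.largest (fun i => hc1 _)
    (fun j => hc0 _) hcsum.le

end IsSplitSVD

/-- Every square matrix has a singular value decomposition with blocks of prescribed sizes, in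
which the leading singular values sum to the Ky Fan norm. -/
theorem exists_isSplitSVD {ι : Type*} (κ κ' : Type*) [Fintype ι] [DecidableEq ι] [Fintype κ]
    [DecidableEq κ] [Fintype κ'] [DecidableEq κ']
    (hcard : Fintype.card κ + Fintype.card κ' = Fintype.card ι) (Z : Matrix ι ι ℝ) :
    ∃ (U₁ : Matrix ι κ ℝ) (d₁ : κ → ℝ) (V₁ : Matrix ι κ ℝ)
      (U₂ : Matrix ι κ' ℝ) (d₂ : κ' → ℝ) (V₂ : Matrix ι κ' ℝ),
      IsSplitSVD Z U₁ d₁ V₁ U₂ d₂ V₂ ∧ ∑ i, d₁ i = kyFanNorm (Fintype.card κ) Z := by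
  obtain ⟨u, v, huv⟩ := exists_orthonormalBasis_singularValues Z
  set σ := (Matrix.toEuclideanLin Z).singularValues with hσ
  have hanti : Antitone σ := (Matrix.toEuclideanLin Z).singularValues_antitone
  have hnn : ∀ i, 0 ≤ σ i := (Matrix.toEuclideanLin Z).singularValues_nonneg
  let e : κ ⊕ κ' ≃ Fin (Fintype.card ι) :=
    ((Equiv.sumCongr (Fintype.equivFin κ) (Fintype.equivFin κ')).trans finSumFinEquiv).trans
      (finCongr hcard)
  have he₁ : ∀ k, (e (Sum.inl k) : ℕ) = Fintype.equivFin κ k := fun k => by simp [e]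
  have he₂ : ∀ k, (e (Sum.inr k) : ℕ) = Fintype.card κ + Fintype.equivFin κ' k := fun k => by
    simp [e]
  have hcols : ∀ w : OrthonormalBasis (Fin (Fintype.card ι)) ℝ (EuclideanSpace ℝ ι),
      (Matrix.of fun i k => w (e k) i)ᵀ * (Matrix.of fun i k => w (e k) i)
        = (1 : Matrix (κ ⊕ κ') (κ ⊕ κ') ℝ) := fun w => by
    ext k k'
    have := w.inner_eq_ite (e k) (e k')
    rw [PiLp.inner_apply] at this
    simp only [Matrix.mul_apply, Matrix.transpose_apply, Matrix.of_apply, Matrix.one_apply]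
    simp only [EmbeddingLike.apply_eq_iff_eq] at this
    rw [← this]
    exact Finset.sum_congr rfl fun i _ => by simp [mul_comm]
  have hcols' : ∀ w : OrthonormalBasis (Fin (Fintype.card ι)) ℝ (EuclideanSpace ℝ ι),
      (Matrix.of fun i k => w (e k) i) * (Matrix.of fun i k => w (e k) i)ᵀ
        = (1 : Matrix ι ι ℝ) := fun w =>
    (Matrix.mul_eq_one_comm_of_card_eq _ _ _ (by simpa using hcard)).1 (hcols w)
  have hsplit : ∀ w : OrthonormalBasis (Fin (Fintype.card ι)) ℝ (EuclideanSpace ℝ ι),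
      Matrix.fromCols (Matrix.of fun i k => w (e (Sum.inl k)) i)
        (Matrix.of fun i k => w (e (Sum.inr k)) i) = Matrix.of fun i k => w (e k) i := fun w => by
    ext i (k | k) <;> rfl
  have hZ : Z = Matrix.of (fun i k => u (e k) i) * Matrix.diagonal (fun k => σ (e k)) *
      (Matrix.of (fun i k => v (e k) i))ᵀ := by
    have h1 : Z * Matrix.of (fun i k => v (e k) i) =
        Matrix.of (fun i k => u (e k) i) * Matrix.diagonal (fun k => σ (e k)) := by
      ext i k
      have := congrArg (fun x => x i) (huv (e k))
      rw [Matrix.mul_diagonal]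
      simp [Matrix.toLpLin_apply] at this
      simp [Matrix.mul_apply]
      rw [mul_comm, ← this]
      rfl
    rw [← h1, Matrix.mul_assoc, hcols', Matrix.mul_one]
  refine ⟨Matrix.of fun i k => u (e (Sum.inl k)) i, fun k => σ (e (Sum.inl k)),
    Matrix.of fun i k => v (e (Sum.inl k)) i, Matrix.of fun i k => u (e (Sum.inr k)) i,
    fun k => σ (e (Sum.inr k)), Matrix.of fun i k => v (e (Sum.inr k)) i,
    ⟨?_, ?_, ?_, ?_, fun _ => hnn _, fun _ => hnn _, fun i j => hanti ?_, ?_⟩, ?_⟩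
  · rw [hsplit]; exact hcols u
  · rw [hsplit]; exact hcols' u
  · rw [hsplit]; exact hcols v
  · rw [hsplit]; exact hcols' v
  · rw [he₁, he₂]
    exact (Fintype.equivFin κ i).2.le.trans (Nat.le_add_right _ _)
  · have hdiag : Matrix.diagonal (fun k => σ (e k)) =
        Matrix.fromBlocks (Matrix.diagonal fun k => σ (e (Sum.inl k))) 0 0
          (Matrix.diagonal fun k => σ (e (Sum.inr k))) := by
      rw [Matrix.fromBlocks_diagonal]
      congr 1
      ext (k | k) <;> rfl
    conv_lhs => rw [hZ, hdiag, ← hsplit u, ← hsplit v, Matrix.transpose_fromCols,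
      Matrix.fromCols_mul_fromBlocks, Matrix.fromCols_mul_fromRows]
    simp
  · simp only [he₁, kyFanNorm]
    rw [Finset.sum_range, (Fintype.equivFin κ).sum_comp (fun i => σ (i : ℕ))]

/-- The Ky Fan norm dominates every pairing with two orthonormal frames. -/
theorem trace_le_kyFanNorm {ι κ : Type*} [Fintype ι] [DecidableEq ι] [Fintype κ] [DecidableEq κ]
    (hcard : Fintype.card κ ≤ Fintype.card ι) (Z : Matrix ι ι ℝ) {P Q : Matrix ι κ ℝ}
    (hP : Pᵀ * P = 1) (hQ : Qᵀ * Q = 1) :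
    (Pᵀ * Z * Q).trace ≤ kyFanNorm (Fintype.card κ) Z := by
  obtain ⟨U₁, d₁, V₁, U₂, d₂, V₂, h, hs⟩ :=
    exists_isSplitSVD κ (Fin (Fintype.card ι - Fintype.card κ)) (by simp; omega) Z
  exact hs ▸ h.trace_le hP hQ

/-- Convexity: the frames of leading singular vectors of a convex combination are test frames for
both of its ends. -/
theorem convexOn_kyFanNorm {ι : Type*} [Fintype ι] [DecidableEq ι] {r : ℕ}
    (hr : r ≤ Fintype.card ι) : ConvexOn ℝ Set.univ (kyFanNorm (ι := ι) r) := by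
  refine ⟨convex_univ, fun Z₁ _ Z₂ _ a b ha hb _ => ?_⟩
  obtain ⟨U₁, d₁, V₁, U₂, d₂, V₂, h, hs⟩ :=
    exists_isSplitSVD (Fin r) (Fin (Fintype.card ι - r)) (by simp; omega) (a • Z₁ + b • Z₂)
  have key := fun Z => trace_le_kyFanNorm (by simpa using hr) Z h.left_blocks.1 h.right_blocks.1
  rw [← h.trace_eq] at hs
  simp only [Fintype.card_fin] at hs key
  rw [← hs]
  simp only [Matrix.mul_add, Matrix.add_mul, Matrix.mul_smul, Matrix.smul_mul, Matrix.trace_add,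
    Matrix.trace_smul]
  exact add_le_add (smul_le_smul_of_nonneg_left (key Z₁) ha)
    (smul_le_smul_of_nonneg_left (key Z₂) hb)

attribute [local instance] Matrix.normedAddCommGroup Matrix.normedSpace in
theorem continuous_kyFanNorm {ι : Type*} [Fintype ι] [DecidableEq ι] {r : ℕ}
    (hr : r ≤ Fintype.card ι) : Continuous (kyFanNorm (ι := ι) r) :=
  (convexOn_kyFanNorm hr).locallyLipschitz.continuous

theorem convexOn_nuclearNorm {ι : Type*} [Fintype ι] [DecidableEq ι] :
    ConvexOn ℝ Set.univ (nuclearNorm (ι := ι)) :=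
  convexOn_kyFanNorm le_rfl

theorem continuous_nuclearNorm {ι : Type*} [Fintype ι] [DecidableEq ι] :
    Continuous (nuclearNorm (ι := ι)) :=
  continuous_kyFanNorm le_rfl

theorem kyFanNorm_le_nuclearNorm {ι : Type*} [Fintype ι] [DecidableEq ι] {r : ℕ}
    (hr : r ≤ Fintype.card ι) (Z : Matrix ι ι ℝ) : kyFanNorm r Z ≤ nuclearNorm Z :=
  Finset.sum_le_sum_of_subset_of_nonneg (Finset.range_subset_range.2 hr)
    fun i _ _ => (Matrix.toEuclideanLin Z).singularValues_nonneg i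

theorem trInner_mul_transpose {ι κ : Type*} [Fintype ι] [Fintype κ]
    (U V : Matrix ι κ ℝ) (X : Matrix ι ι ℝ) :
    trInner (U * Vᵀ) X = (Uᵀ * X * V).trace := by
  rw [trInner, Matrix.transpose_mul, Matrix.transpose_transpose, Matrix.mul_assoc,
    Matrix.trace_mul_comm]

/-- The leading singular vectors of `Z` give a subgradient of the Ky Fan norm at `Z`. -/
theorem IsSplitSVD.mul_transpose_mem_subdiff {ι κ κ' : Type*} [Fintype ι] [DecidableEq ι]
    [Fintype κ] [DecidableEq κ] [Fintype κ'] [DecidableEq κ'] {Z : Matrix ι ι ℝ}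
    {U₁ : Matrix ι κ ℝ} {d₁ : κ → ℝ} {V₁ : Matrix ι κ ℝ}
    {U₂ : Matrix ι κ' ℝ} {d₂ : κ' → ℝ} {V₂ : Matrix ι κ' ℝ}
    (hcard : Fintype.card κ ≤ Fintype.card ι)
    (h : IsSplitSVD Z U₁ d₁ V₁ U₂ d₂ V₂) :
    U₁ * V₁ᵀ ∈ subdiff (kyFanNorm (Fintype.card κ)) Z := by
  intro Z'
  have hle : kyFanNorm (Fintype.card κ) Z ≤ (U₁ᵀ * Z * V₁).trace := by
    obtain ⟨P, d, Q, _, _, _, h', hs⟩ :=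
      exists_isSplitSVD κ (Fin (Fintype.card ι - Fintype.card κ)) (by simp; omega) Z
    rw [← hs, ← h'.trace_eq, h.trace_eq]
    exact h.trace_le h'.left_blocks.1 h'.right_blocks.1
  have hge := trace_le_kyFanNorm hcard Z' h.left_blocks.1 h.right_blocks.1
  rw [trInner_mul_transpose, Matrix.mul_sub, Matrix.sub_mul, Matrix.trace_sub]
  linarith

/-- The matrices built from pairs of orthonormal frames are uniformly bounded. -/
theorem abs_mul_transpose_apply_le {ι κ : Type*} [Fintype ι] [Fintype κ] [DecidableEq κ]
    {U V : Matrix ι κ ℝ} (hU : Uᵀ * U = 1) (hV : Vᵀ * V = 1) (i j : ι) :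
    |(U * Vᵀ) i j| ≤ 1 := by
  have h1 := sum_sq_row_le_one hU i
  have h2 := sum_sq_row_le_one hV j
  have h3 : |∑ k, U i k * V j k| ≤ ∑ k, (U i k ^ 2 + V j k ^ 2) / 2 :=
    (Finset.abs_sum_le_sum_abs _ _).trans <| Finset.sum_le_sum fun k _ => by
      rw [abs_le]
      constructor <;> nlinarith [sq_nonneg (U i k - V j k), sq_nonneg (U i k + V j k)]
  rw [← Finset.sum_div, Finset.sum_add_distrib] at h3
  simp only [Matrix.mul_apply, Matrix.transpose_apply]
  linarith

/-! ### Subgradients by separation, and multipliers for the two constraint sets -/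

section TrInner

variable {ι κ : Type*} [Fintype ι] [Fintype κ]

theorem trInner_eq_sum (X Y : Matrix ι κ ℝ) : trInner X Y = ∑ i, ∑ j, X i j * Y i j := by
  rw [trInner, Finset.sum_comm]
  simp [Matrix.trace, Matrix.mul_apply]

/-- The trace inner product as a bilinear map. -/
def trInnerₗ : Matrix ι κ ℝ →ₗ[ℝ] Matrix ι κ ℝ →ₗ[ℝ] ℝ :=
  LinearMap.mk₂ ℝ trInner
    (fun X X' Y => by simp [trInner, Matrix.add_mul])
    (fun c X Y => by simp [trInner])
    (fun X Y Y' => by simp [trInner, Matrix.mul_add])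
    (fun c X Y => by simp [trInner])

theorem trInnerₗ_apply (X Y : Matrix ι κ ℝ) : trInnerₗ X Y = trInner X Y := rfl

theorem continuous_trInner :
    Continuous fun p : Matrix ι κ ℝ × Matrix ι κ ℝ => trInner p.1 p.2 := by
  unfold trInner
  fun_prop

theorem tendsto_trInner {α : Type*} {F : Filter α} {X Y : α → Matrix ι κ ℝ}
    {Xs Ys : Matrix ι κ ℝ} (hX : Tendsto X F (𝓝 Xs)) (hY : Tendsto Y F (𝓝 Ys)) :
    Tendsto (fun k => trInner (X k) (Y k)) F (𝓝 (trInner Xs Ys)) := by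
  have h := (continuous_trInner (ι := ι) (κ := κ)).continuousAt (x := (Xs, Ys))
  have h' := h.tendsto.comp (hX.prodMk_nhds hY)
  exact h'

theorem exists_trInner_eq [DecidableEq ι] [DecidableEq κ] (φ : Matrix ι κ ℝ →ₗ[ℝ] ℝ) :
    ∃ K : Matrix ι κ ℝ, ∀ X, φ X = trInner K X := by
  refine ⟨Matrix.of fun i j => φ (Matrix.single i j 1), fun X => ?_⟩
  conv_lhs => rw [Matrix.matrix_eq_sum_single X]
  rw [map_sum, trInner_eq_sum]
  refine Finset.sum_congr rfl fun i _ => ?_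
  rw [map_sum]
  refine Finset.sum_congr rfl fun j _ => ?_
  have : Matrix.single i j (X i j) = X i j • Matrix.single i j (1 : ℝ) := by simp
  rw [this, map_smul, smul_eq_mul, Matrix.of_apply, mul_comm]

end TrInner

/-- Separation of the strict epigraph of a continuous convex function `g` from a convex set `C`
below the graph: at a contact point there is a subgradient of `g` whose affine minorant still lies
above `C`. -/
theorem exists_subgradient_separating {E : Type*} [TopologicalSpace E] [AddCommGroup E]
    [Module ℝ E] [IsTopologicalAddGroup E] [ContinuousSMul ℝ E] {g : E → ℝ}
    (hg : ConvexOn ℝ Set.univ g) (hgc : Continuous g) {C : Set (E × ℝ)} (hC : Convex ℝ C)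
    (hle : ∀ p ∈ C, p.2 ≤ g p.1) {z₀ : E} (hz₀ : (z₀, g z₀) ∈ C) :
    ∃ φ : E →ₗ[ℝ] ℝ, (∀ z, g z₀ + φ (z - z₀) ≤ g z) ∧
      ∀ p ∈ C, p.2 ≤ g z₀ + φ (p.1 - z₀) := by
  have hconv : Convex ℝ {p : E × ℝ | g p.1 < p.2} := by
    simpa using hg.convex_strict_epigraph
  have hopen : IsOpen {p : E × ℝ | g p.1 < p.2} :=
    isOpen_lt (hgc.comp continuous_fst) continuous_snd
  have hdisj : Disjoint {p : E × ℝ | g p.1 < p.2} C :=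
    Set.disjoint_left.2 fun p hp hp' => (hle p hp').not_gt hp
  obtain ⟨f, u, hfs, hft⟩ := geometric_hahn_banach_open hconv hopen hC hdisj
  set lam := f (0, 1) with hlam
  have hf : ∀ z t, f (z, t) = f (z, 0) + t * lam := fun z t => by
    have : ((z, t) : E × ℝ) = (z, 0) + t • (0, 1) := by ext <;> simp
    rw [this, map_add, map_smul, smul_eq_mul]
  have hneg : lam < 0 := by
    have h1 := hfs (z₀, g z₀ + 1) (by simp)
    have h2 := hft _ hz₀
    rw [hf] at h1 h2
    linarith
  have hgraph : ∀ z, f (z, 0) + g z * lam ≤ u := fun z => by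
    refine le_of_forall_pos_le_add fun δ hδ => ?_
    have h1 := hfs (z, g z + δ / (-lam)) (by simpa using div_pos hδ (by linarith))
    rw [hf, add_mul, div_mul_eq_mul_div, div_neg, mul_div_assoc, div_self hneg.ne] at h1
    linarith
  have hz₀u := le_antisymm (hgraph z₀) (by simpa [hf z₀ (g z₀)] using hft _ hz₀)
  let φ : E →ₗ[ℝ] ℝ := (-lam)⁻¹ • (f.toLinearMap ∘ₗ LinearMap.inl ℝ E ℝ)
  have hφ : ∀ z, φ (z - z₀) = (f (z, 0) - f (z₀, 0)) / (-lam) := fun z => by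
    have : ((z - z₀, 0) : E × ℝ) = (z, 0) - (z₀, 0) := by ext <;> simp
    simp only [φ, LinearMap.smul_apply, LinearMap.comp_apply, LinearMap.inl_apply, smul_eq_mul]
    rw [ContinuousLinearMap.coe_coe, this, map_sub, div_eq_inv_mul]
  have hpos : 0 < -lam := by linarith
  refine ⟨φ, fun z => ?_, fun p hp => ?_⟩
  · rw [hφ, ← le_sub_iff_add_le', div_le_iff₀ hpos]
    nlinarith [hgraph z]
  · rw [hφ, ← sub_le_iff_le_add', le_div_iff₀ hpos]
    have h := hft p hp
    rw [show p = (p.1, p.2) from rfl, hf] at h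
    nlinarith

/-- Linear programming duality on the box `[0, 1]^ι` cut by `s ≤ ∑ xᵢ`. -/
theorem exists_multipliers_box {ι : Type*} [Fintype ι] [DecidableEq ι] {p x : ι → ℝ} {s : ℝ}
    (hx1 : ∀ i, x i ≤ 1) (hx0 : ∀ i, 0 ≤ x i) (hxs : s ≤ ∑ i, x i)
    (hmin : ∀ y : ι → ℝ, (∀ i, y i ≤ 1) → (∀ i, 0 ≤ y i) → s ≤ ∑ i, y i →
      ∑ i, p i * x i ≤ ∑ i, p i * y i) :
    ∃ (a b : ι → ℝ) (c : ℝ), (∀ i, 0 ≤ a i) ∧ (∀ i, 0 ≤ b i) ∧ 0 ≤ c ∧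
      (∀ i, a i * x i = 0) ∧ (∀ i, b i * (1 - x i) = 0) ∧ c * (∑ i, x i - s) = 0 ∧
      ∀ i, p i = a i - b i + c := by
  -- raising one coordinate
  have hup : ∀ i, x i < 1 → 0 ≤ p i := fun i hi => by
    have h := hmin (x + Pi.single i (1 - x i)) (fun k => ?_) (fun k => ?_) ?_
    · simp only [Pi.add_apply, mul_add, Finset.sum_add_distrib, Pi.single_apply, mul_ite,
        mul_zero, Finset.sum_ite_eq', Finset.mem_univ, if_true] at h
      nlinarith
    · rcases eq_or_ne k i with rfl | hk
      · simp
      · simpa [hk] using hx1 k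
    · rcases eq_or_ne k i with rfl | hk
      · simp
      · simpa [hk] using hx0 k
    · simp only [Pi.add_apply, Finset.sum_add_distrib, Finset.sum_pi_single', Finset.mem_univ,
        if_true]
      linarith
  -- lowering one coordinate when the sum constraint is slack
  have hdown : s < ∑ i, x i → ∀ j, 0 < x j → p j ≤ 0 := fun hs j hj => by
    obtain ⟨t, ht0, ht1, ht2⟩ : ∃ t : ℝ, 0 < t ∧ t ≤ x j ∧ t ≤ ∑ i, x i - s :=
      ⟨min (x j) (∑ i, x i - s), lt_min hj (by linarith), min_le_left _ _, min_le_right _ _⟩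
    have h := hmin (x - Pi.single j t) (fun k => ?_) (fun k => ?_) ?_
    · simp only [Pi.sub_apply, mul_sub, Finset.sum_sub_distrib, Pi.single_apply, mul_ite,
        mul_zero, Finset.sum_ite_eq', Finset.mem_univ, if_true] at h
      nlinarith
    · rcases eq_or_ne k j with rfl | hk
      · simp; linarith [hx1 k]
      · simpa [hk] using hx1 k
    · rcases eq_or_ne k j with rfl | hk
      · simpa using ht1
      · simpa [hk] using hx0 k
    · simp only [Pi.sub_apply, Finset.sum_sub_distrib, Finset.sum_pi_single', Finset.mem_univ,
        if_true]
      linarith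
  -- moving mass from coordinate `j` to coordinate `i`
  have hswap : ∀ i j, x i < 1 → 0 < x j → p j ≤ p i := fun i j hi hj => by
    rcases eq_or_ne i j with rfl | hij
    · exact le_rfl
    obtain ⟨t, ht0, ht1, ht2⟩ : ∃ t : ℝ, 0 < t ∧ t ≤ x j ∧ t ≤ 1 - x i :=
      ⟨min (x j) (1 - x i), lt_min hj (by linarith), min_le_left _ _, min_le_right _ _⟩
    have h := hmin (x + Pi.single i t - Pi.single j t) (fun k => ?_) (fun k => ?_) ?_
    · simp only [Pi.sub_apply, Pi.add_apply, mul_add, mul_sub, Finset.sum_sub_distrib,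
        Finset.sum_add_distrib, Pi.single_apply, mul_ite,
        mul_zero, Finset.sum_ite_eq', Finset.mem_univ, if_true] at h
      nlinarith
    · rcases eq_or_ne k i with rfl | hk
      · simp [hij]; linarith
      · rcases eq_or_ne k j with rfl | hk'
        · simp [hk]; linarith [hx1 k]
        · simpa [hk, hk'] using hx1 k
    · rcases eq_or_ne k i with rfl | hk
      · simp [hij]; linarith [hx0 k]
      · rcases eq_or_ne k j with rfl | hk'
        · simpa [hk] using ht1
        · simpa [hk, hk'] using hx0 k
    · simp only [Pi.sub_apply, Pi.add_apply, Finset.sum_sub_distrib, Finset.sum_add_distrib,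
        Finset.sum_pi_single', Finset.mem_univ, if_true]
      linarith
  obtain ⟨c, hc0, hcl, hcu, hcs⟩ : ∃ c : ℝ, 0 ≤ c ∧ (∀ i, x i < 1 → c ≤ p i) ∧
      (∀ j, 0 < x j → p j ≤ c) ∧ c * (∑ i, x i - s) = 0 := by
    rcases hxs.lt_or_eq with hs | hs
    · exact ⟨0, le_rfl, hup, hdown hs, zero_mul _⟩
    · rcases (Finset.univ.filter fun j => 0 < x j).eq_empty_or_nonempty with he | hne
      · refine ⟨0, le_rfl, hup, fun j hj => ?_, zero_mul _⟩
        have hj' : j ∈ Finset.univ.filter fun j => 0 < x j := by simpa using hj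
        simp [he] at hj'
      · obtain ⟨j₀, hj₀, hmax⟩ := Finset.exists_max_image _ p hne
        refine ⟨max 0 (p j₀), le_max_left _ _, fun i hi => max_le (hup i hi) ?_,
          fun j hj => (hmax j (by simpa using hj)).trans (le_max_right _ _), by simp [hs]⟩
        exact hswap i j₀ hi (by simpa using hj₀)
  refine ⟨fun i => max (p i - c) 0, fun i => max (c - p i) 0, c, fun i => le_max_right _ _,
    fun i => le_max_right _ _, hc0, fun i => ?_, fun i => ?_, hcs, fun i => ?_⟩ <;> dsimp only
  · rcases (hx0 i).eq_or_lt with h | h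
    · rw [← h, mul_zero]
    · rw [max_eq_right (by linarith [hcu i h]), zero_mul]
  · rcases (hx1 i).eq_or_lt with h | h
    · rw [h, sub_self, mul_zero]
    · rw [max_eq_right (by linarith [hcl i h]), zero_mul]
  · rcases le_total (p i) c with h | h
    · rw [max_eq_right (by linarith), max_eq_left (by linarith)]; ring
    · rw [max_eq_left (by linarith), max_eq_right (by linarith)]; ring

/-- Conic duality on the shifted cone `W ⪰ W₀`: a linear functional minimized there at `W` is, on
symmetric matrices, the pairing with a positive semidefinite multiplier complementary to
`W - W₀`. -/
theorem exists_multiplier_posSemidef {ι : Type*} [Fintype ι] [DecidableEq ι]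
    {ψ : Matrix ι ι ℝ →ₗ[ℝ] ℝ} {W W₀ : Matrix ι ι ℝ} (hW : (W - W₀).PosSemidef)
    (hmin : ∀ X : Matrix ι ι ℝ, (X - W₀).PosSemidef → ψ W ≤ ψ X) :
    ∃ S : Matrix ι ι ℝ, S.PosSemidef ∧ trInner S (W - W₀) = 0 ∧
      ∀ X : Matrix ι ι ℝ, X.IsSymm → trInner S X = ψ X := by
  obtain ⟨K, hK⟩ := exists_trInner_eq ψ
  have hS : ∀ X : Matrix ι ι ℝ, X.IsSymm → trInner ((1 / 2 : ℝ) • (K + Kᵀ)) X = ψ X := by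
    intro X hX
    have hT : trInner Kᵀ X = trInner K X := by
      rw [trInner, Matrix.transpose_transpose, ← Matrix.trace_transpose, Matrix.transpose_mul,
        hX.eq, Matrix.trace_mul_comm, trInner]
    simp only [← trInnerₗ_apply, map_smul, map_add, LinearMap.smul_apply, LinearMap.add_apply,
      smul_eq_mul, hK] at hT ⊢
    rw [hT]
    ring
  have hpsd : ∀ X : Matrix ι ι ℝ, X.PosSemidef → 0 ≤ ψ X := fun X hX => by
    have := hmin (W + X) (by rw [add_sub_right_comm]; exact hW.add hX)
    rw [map_add] at this
    linarith
  refine ⟨(1 / 2 : ℝ) • (K + Kᵀ), ?_, ?_, hS⟩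
  · refine Matrix.PosSemidef.of_dotProduct_mulVec_nonneg ?_ fun x => ?_
    · ext i j
      simp [mul_add, add_comm]
    · have hxx : (Matrix.vecMulVec x x).PosSemidef := by
        simpa using Matrix.posSemidef_vecMulVec_self_star x
      have h := hpsd _ hxx
      rw [← hS _ (by ext i j; simp [Matrix.vecMulVec_apply, mul_comm]), trInner_eq_sum] at h
      refine h.trans_eq ?_
      simp only [dotProduct, Matrix.mulVec, Finset.mul_sum, Matrix.vecMulVec_apply, star_trivial]
      exact Finset.sum_congr rfl fun i _ => Finset.sum_congr rfl fun j _ => by ring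
  · rw [hS _ (by simpa [Matrix.IsHermitian, Matrix.IsSymm] using hW.isHermitian)]
    -- the apex `W₀` is admissible
    have h1 := hmin W₀ (by rw [sub_self]; exact Matrix.PosSemidef.zero)
    have h2 := hpsd _ hW
    rw [map_sub] at h2 ⊢
    linarith

/-! ### The KKT conditions -/

namespace RelaxData

variable {n m l : ℕ} (P : RelaxData n m l)

/-- The linear part of the affine map `(θ, W) ↦ Zmat θ W`. -/
def Zlin : EuclideanSpace ℝ (Fin l) × Matrix (Fin n) (Fin n) ℝ →ₗ[ℝ]
    Matrix (ZIdx n m) (ZIdx n m) ℝ where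
  toFun q := P.Zmat q.1 q.2 - P.Zmat 0 0
  map_add' q q' := by
    ext (i | i | i | i) (j | j | j | j) <;>
      simp [Zmat, Mmat, Nmat, Aθ, Bθ, add_mul, Finset.sum_add_distrib, Matrix.sum_apply]
  map_smul' c q := by
    ext (i | i | i | i) (j | j | j | j) <;>
      simp [Zmat, Mmat, Nmat, Aθ, Bθ, mul_assoc, Finset.mul_sum, Matrix.sum_apply]

theorem Zmat_sub (θ θ' : EuclideanSpace ℝ (Fin l)) (W W' : Matrix (Fin n) (Fin n) ℝ) :
    P.Zmat θ W - P.Zmat θ' W' = P.Zlin (θ - θ', W - W') := by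
  have : ((θ - θ', W - W') : EuclideanSpace ℝ (Fin l) × Matrix (Fin n) (Fin n) ℝ)
      = (θ, W) - (θ', W') := rfl
  rw [this, map_sub]
  simp [Zlin]

theorem Zlin_eq_sum (θ : EuclideanSpace ℝ (Fin l)) (W : Matrix (Fin n) (Fin n) ℝ) :
    P.Zlin (θ, W) = ∑ i, θ i • P.Zlin (EuclideanSpace.single i 1, 0) + P.Zlin (0, W) := by
  have h : ((θ, W) : EuclideanSpace ℝ (Fin l) × Matrix (Fin n) (Fin n) ℝ) =
      ∑ i, θ i • (EuclideanSpace.single i 1, 0) + (0, W) := by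
    ext i
    · simp [Prod.fst_sum, Finset.sum_apply, Pi.single_apply]
    · simp [Prod.snd_sum]
  conv_lhs => rw [h]
  simp only [map_add, map_sum, map_smul]

theorem continuous_Zmat :
    Continuous fun q : EuclideanSpace ℝ (Fin l) × Matrix (Fin n) (Fin n) ℝ => P.Zmat q.1 q.2 := by
  have h : (fun q : EuclideanSpace ℝ (Fin l) × Matrix (Fin n) (Fin n) ℝ => P.Zmat q.1 q.2) =
      fun q => P.Zlin q + P.Zmat 0 0 := by
    ext1 q
    simp [Zlin]
  rw [h]
  exact P.Zlin.continuous_of_finiteDimensional.add continuous_const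

variable {P}

theorem Feasible.convex_comb {θ θ' : EuclideanSpace ℝ (Fin l)} {W W' : Matrix (Fin n) (Fin n) ℝ}
    {Z Z' : Matrix (ZIdx n m) (ZIdx n m) ℝ} (h : P.Feasible θ W Z) (h' : P.Feasible θ' W' Z')
    {a b : ℝ} (ha : 0 ≤ a) (hb : 0 ≤ b) (hab : a + b = 1) :
    P.Feasible (a • θ + b • θ') (a • W + b • W') (a • Z + b • Z') := by
  refine ⟨?_, ?_, fun i => ?_, fun i => ?_, ?_⟩
  · have e : P.Zmat (a • θ + b • θ') (a • W + b • W') - P.Zmat 0 0 =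
        a • (P.Zmat θ W - P.Zmat 0 0) + b • (P.Zmat θ' W' - P.Zmat 0 0) := by
      have := P.Zlin.map_add (a • (θ, W)) (b • (θ', W'))
      rw [map_smul, map_smul] at this
      exact this
    rw [h.Z_eq, h'.Z_eq, ← sub_eq_zero]
    calc _ = a • (P.Zmat θ W - P.Zmat 0 0) + b • (P.Zmat θ' W' - P.Zmat 0 0)
          - (P.Zmat (a • θ + b • θ') (a • W + b • W') - P.Zmat 0 0)
          + (a + b - 1) • P.Zmat 0 0 := by module
      _ = 0 := by rw [e, hab]; module
  · have e : a • W + b • W' - P.ε • (1 : Matrix (Fin n) (Fin n) ℝ) =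
        a • (W - P.ε • 1) + b • (W' - P.ε • 1) := by
      obtain rfl : b = 1 - a := by linarith
      module
    rw [e]
    exact (h.W_ge.smul ha).add (h'.W_ge.smul hb)
  · simp only [PiLp.add_apply, PiLp.smul_apply, smul_eq_mul]
    nlinarith [h.le_one i, h'.le_one i]
  · simp only [PiLp.add_apply, PiLp.smul_apply, smul_eq_mul]
    exact add_nonneg (mul_nonneg ha (h.nonneg i)) (mul_nonneg hb (h'.nonneg i))
  · simp only [PiLp.add_apply, PiLp.smul_apply, smul_eq_mul, Finset.sum_add_distrib,
      ← Finset.mul_sum]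
    have h1 := mul_le_mul_of_nonneg_left h.sum_ge ha
    have h2 := mul_le_mul_of_nonneg_left h'.sum_ge hb
    have h3 : (a + b) * (1 - P.η) = 1 - P.η := by rw [hab, one_mul]
    linarith

/-- A feasible point that solves the convex program linearized at itself, with a subgradient `H`
of the Ky Fan norm, satisfies the KKT conditions. -/
theorem isStationary_of_forall_le (hγ : 0 < P.γ) {θs : EuclideanSpace ℝ (Fin l)}
    {Ws : Matrix (Fin n) (Fin n) ℝ} {Zs H : Matrix (ZIdx n m) (ZIdx n m) ℝ}
    (hfeas : P.Feasible θs Ws Zs) (hH : H ∈ subdiff (kyFanNorm (2 * n + m)) Zs)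
    (hmin : ∀ θ W Z, P.Feasible θ W Z →
      P.γ * nuclearNorm Zs + (∑ i, P.weight (θs i) * θs i) - P.γ * trInner H Zs ≤
        P.γ * nuclearNorm Z + (∑ i, P.weight (θs i) * θ i) - P.γ * trInner H Z) :
    P.IsStationary θs Ws Zs := by
  set w : Fin l → ℝ := fun i => P.weight (θs i) with hw
  set g : Matrix (ZIdx n m) (ZIdx n m) ℝ → ℝ := fun Z =>
    P.γ * nuclearNorm Z - P.γ * trInner H Z with hg
  have hlin : ∀ K : Matrix (ZIdx n m) (ZIdx n m) ℝ, ∀ X Y,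
      trInner K (X - Y) = trInner K X - trInner K Y := fun K X Y => (trInnerₗ K).map_sub X Y
  have hgconv : ConvexOn ℝ Set.univ g := by
    have h1 := (convexOn_nuclearNorm (ι := ZIdx n m)).smul hγ.le
    exact h1.sub ((P.γ • trInnerₗ H).concaveOn convex_univ)
  have hgcont : Continuous g :=
    (continuous_const.mul continuous_nuclearNorm).sub
      (continuous_const.mul (continuous_trInner.comp (Continuous.prodMk_right H)))
  -- the level of the objective left to `g` by the linear term in `θ`, over the feasible points
  set C : Set (Matrix (ZIdx n m) (ZIdx n m) ℝ × ℝ) :=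
    {p | ∃ θ W, P.Feasible θ W p.1 ∧ p.2 = g Zs + ∑ i, w i * θs i - ∑ i, w i * θ i} with hC
  have hCconv : Convex ℝ C := by
    rintro ⟨Z, t⟩ ⟨θ, W, hf, ht⟩ ⟨Z', t'⟩ ⟨θ', W', hf', ht'⟩ a b ha hb hab
    refine ⟨_, _, hf.convex_comb hf' ha hb hab, ?_⟩
    simp only at ht ht'
    simp only [Prod.smul_mk, Prod.mk_add_mk, smul_eq_mul, ht, ht', PiLp.add_apply,
      PiLp.smul_apply, mul_add, Finset.sum_add_distrib, mul_left_comm _ a, mul_left_comm _ b,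
      ← Finset.mul_sum]
    obtain rfl : b = 1 - a := by linarith
    ring
  have hCle : ∀ p ∈ C, p.2 ≤ g p.1 := by
    rintro ⟨Z, t⟩ ⟨θ, W, hf, ht⟩
    have := hmin θ W Z hf
    simp only at ht
    simp only [ht, hg, hw]
    linarith
  obtain ⟨φ, hφg, hφC⟩ := exists_subgradient_separating hgconv hgcont hCconv hCle
    (z₀ := Zs) ⟨θs, Ws, hfeas, by ring⟩
  obtain ⟨K, hK⟩ := exists_trInner_eq φ
  simp only [hK] at hφg hφC
  have hvar : ∀ θ W, P.Feasible θ W (P.Zmat θ W) →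
      ∑ i, w i * θs i ≤ ∑ i, w i * θ i + trInner K (P.Zlin (θ - θs, W - Ws)) := by
    intro θ W hf
    have h := hφC (P.Zmat θ W, g Zs + ∑ i, w i * θs i - ∑ i, w i * θ i) ⟨θ, W, hf, rfl⟩
    simp only [hfeas.Z_eq, Zmat_sub] at h
    linarith
  set p : Fin l → ℝ := fun i => w i + trInner K (P.Zlin (EuclideanSpace.single i 1, 0)) with hp
  set ψ : Matrix (Fin n) (Fin n) ℝ →ₗ[ℝ] ℝ :=
    trInnerₗ K ∘ₗ P.Zlin ∘ₗ LinearMap.inr ℝ _ _ with hψ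
  have hsplit : ∀ (dθ : EuclideanSpace ℝ (Fin l)) dW,
      ∑ i, w i * dθ i + trInner K (P.Zlin (dθ, dW)) = ∑ i, p i * dθ i + ψ dW := by
    intro dθ dW
    rw [Zlin_eq_sum, ← trInnerₗ_apply, map_add, map_sum, ← add_assoc, ← Finset.sum_add_distrib]
    congr 1
    refine Finset.sum_congr rfl fun i _ => ?_
    rw [map_smul, smul_eq_mul, trInnerₗ_apply, hp]
    ring
  obtain ⟨a, b, c, ha, hb, hc, hax, hbx, hcx, hpabc⟩ :=
    exists_multipliers_box (p := p) (x := fun i => θs i) (s := 1 - P.η) hfeas.le_one hfeas.nonneg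
      hfeas.sum_ge (by
        intro y hy1 hy0 hys
        have h := hvar (WithLp.toLp 2 y) Ws ⟨rfl, hfeas.W_ge, hy1, hy0, hys⟩
        have h2 := hsplit (WithLp.toLp 2 y - θs) (Ws - Ws)
        rw [sub_self, map_zero] at h2
        simp only [PiLp.sub_apply, mul_sub, Finset.sum_sub_distrib, sub_self] at h h2
        linarith)
  obtain ⟨S, hS, hSW, hSψ⟩ := exists_multiplier_posSemidef (ψ := ψ) hfeas.W_ge (by
    intro X hX
    have h := hvar θs X ⟨rfl, hX, hfeas.le_one, hfeas.nonneg, hfeas.sum_ge⟩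
    have h2 := hsplit (θs - θs) (X - Ws)
    rw [map_sub] at h2
    simp only [sub_self, PiLp.zero_apply, mul_zero, Finset.sum_const_zero] at h h2
    linarith)
  refine ⟨hfeas, H + P.γ⁻¹ • K, ?_, H, hH, -K, S, a, b, c, hS, ha, hb, hc, hSW, hax, hbx, hcx, ?_⟩
  · intro Z'
    have h := hφg Z'
    have e : trInner (H + P.γ⁻¹ • K) (Z' - Zs) =
        trInner H Z' - trInner H Zs + P.γ⁻¹ * trInner K (Z' - Zs) := by
      rw [← hlin]
      simp [← trInnerₗ_apply]
    simp only [hg] at h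
    rw [e]
    have h2 : P.γ * (P.γ⁻¹ * trInner K (Z' - Zs)) = trInner K (Z' - Zs) := by
      rw [← mul_assoc, mul_inv_cancel₀ hγ.ne', one_mul]
    refine le_of_mul_le_mul_left ?_ hγ
    linarith
  · intro dθ dW dZ hdW
    have e1 : trInner (H + P.γ⁻¹ • K) dZ = trInner H dZ + P.γ⁻¹ * trInner K dZ := by
      simp [← trInnerₗ_apply]
    have e2 : trInner (-K) (dZ - P.Zlin (dθ, dW)) =
        trInner K (P.Zlin (dθ, dW)) - trInner K dZ := by
      simp [← trInnerₗ_apply]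
    have e3 : P.γ * (P.γ⁻¹ * trInner K dZ) = trInner K dZ := by
      rw [← mul_assoc, mul_inv_cancel₀ hγ.ne', one_mul]
    have e4 := hsplit dθ dW
    have e5 : ∑ i, p i * dθ i = ∑ i, a i * dθ i - ∑ i, b i * dθ i + c * ∑ i, dθ i := by
      simp only [hpabc, add_mul, sub_mul, Finset.sum_add_distrib, Finset.sum_sub_distrib,
        Finset.mul_sum]
    rw [Zmat_sub, add_sub_cancel_left, add_sub_cancel_left, e1, e2, hSψ dW hdW]
    linarith

end RelaxData

/-! ### Majorization and descent -/

/-- Uniform strong concavity of `t ↦ log (1 + t / τ)` on `[0, 1]`. -/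
theorem exists_log_one_add_div_le {τ : ℝ} (hτ : 0 < τ) :
    ∃ κ : ℝ, 0 < κ ∧ ∀ s ∈ Set.Icc (0 : ℝ) 1, ∀ t ∈ Set.Icc (0 : ℝ) 1,
      Real.log (1 + t / τ) + κ * (t - s) ^ 2 ≤
        Real.log (1 + s / τ) + τ⁻¹ / (1 + s * τ⁻¹) * (t - s) := by
  set R := √((τ + 1) / τ) + 1 with hR
  have hRpos : 0 < R := by positivity
  refine ⟨(((τ + 1) * R) ^ 2)⁻¹, by positivity, fun s hs t ht => ?_⟩
  have hs0 := hs.1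
  have ht0 := ht.1
  have hτs : 0 < τ + s := by linarith
  have hτt : 0 < τ + t := by linarith
  set y := (τ + t) / (τ + s) with hy
  have hypos : 0 < y := div_pos hτt hτs
  set r := √y with hr
  have hr0 : 0 < r := Real.sqrt_pos.2 hypos
  have hr2 : r ^ 2 = y := Real.sq_sqrt hypos.le
  have hrR : r + 1 ≤ R := by
    refine add_le_add_left (Real.sqrt_le_sqrt ?_) 1
    rw [hy, div_le_div_iff₀ hτs hτ]
    nlinarith [ht.2, mul_nonneg hτ.le hs0]
  have hlog : Real.log (1 + t / τ) = Real.log (1 + s / τ) + Real.log y := by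
    rw [← Real.log_mul (by positivity) hypos.ne']
    congr 1
    rw [hy]
    field_simp
  -- `log y = 2 log r ≤ 2 (r - 1) = (y - 1) - (r - 1)²`
  have hlogy : Real.log y ≤ (y - 1) - (r - 1) ^ 2 := by
    have h1 : Real.log y = 2 * Real.log r := by
      rw [← hr2, Real.log_pow]; norm_num
    have h2 := Real.log_le_sub_one_of_pos hr0
    nlinarith
  have hy1 : (y - 1) * (τ + s) = t - s := by
    rw [hy]; field_simp; ring
  have hquad : (((τ + 1) * R) ^ 2)⁻¹ * (t - s) ^ 2 ≤ (r - 1) ^ 2 := by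
    rw [inv_mul_le_iff₀ (by positivity)]
    have e : (t - s) ^ 2 = ((τ + s) * (r + 1)) ^ 2 * (r - 1) ^ 2 := by
      rw [← hy1, ← hr2]; ring
    rw [e]
    refine mul_le_mul_of_nonneg_right ?_ (sq_nonneg _)
    refine pow_le_pow_left₀ (by positivity) ?_ 2
    exact mul_le_mul (by linarith [hs.2]) hrR (by positivity) (by positivity)
  have hderiv : τ⁻¹ / (1 + s * τ⁻¹) * (t - s) = y - 1 := by
    rw [← hy1]
    field_simp
  rw [hlog, hderiv]
  linarith

namespace RelaxData

variable {n m l : ℕ} {P : RelaxData n m l}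

theorem card_ZIdx_ge (n m : ℕ) : 2 * n + m ≤ Fintype.card (ZIdx n m) := by
  simp; omega

/-- One iteration, expressed through the slope `H = U₁ V₁ᵀ` of the linearized Ky Fan norm. -/
theorem Step.exists_subgradient {θk θ' : EuclideanSpace ℝ (Fin l)}
    {W' : Matrix (Fin n) (Fin n) ℝ} {Zk Z' : Matrix (ZIdx n m) (ZIdx n m) ℝ}
    (h : P.Step θk Zk θ' W' Z') :
    ∃ H ∈ subdiff (kyFanNorm (2 * n + m)) Zk, (∀ i j, |H i j| ≤ 1) ∧
      P.Feasible θ' W' Z' ∧ ∀ θ W Z, P.Feasible θ W Z →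
        P.γ * nuclearNorm Z' + (∑ i, P.weight (θk i) * θ' i) - P.γ * trInner H Z' ≤
          P.γ * nuclearNorm Z + (∑ i, P.weight (θk i) * θ i) - P.γ * trInner H Z := by
  obtain ⟨U₁, d₁, V₁, U₂, d₂, V₂, hsvd, hf, hmin⟩ := h
  have hcard : Fintype.card (MidIdx n m) = 2 * n + m := by simp; omega
  refine ⟨U₁ * V₁ᵀ, ?_, fun i j => ?_, hf, fun θ W Z hZ => ?_⟩
  · rw [← hcard]
    exact hsvd.mul_transpose_mem_subdiff (hcard ▸ card_ZIdx_ge n m)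
  · exact abs_mul_transpose_apply_le hsvd.left_blocks.1 hsvd.right_blocks.1 i j
  · simpa only [subObj, trInner_mul_transpose] using hmin θ W Z hZ

/-- The linearized objective majorizes `F` up to a constant, with a quadratic margin in `θ`. -/
theorem exists_F_le (hτ : 0 < P.τ) (hγ : 0 < P.γ) :
    ∃ κ : ℝ, 0 < κ ∧ ∀ {θ θ' : EuclideanSpace ℝ (Fin l)} {W W' : Matrix (Fin n) (Fin n) ℝ}
      {Z Z' H : Matrix (ZIdx n m) (ZIdx n m) ℝ},
      P.Feasible θ W Z → P.Feasible θ' W' Z' → H ∈ subdiff (kyFanNorm (2 * n + m)) Z →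
      P.F θ' W' Z' + κ * ‖θ' - θ‖ ^ 2 ≤ P.F θ W Z
        + (P.γ * nuclearNorm Z' + (∑ i, P.weight (θ i) * θ' i) - P.γ * trInner H Z')
        - (P.γ * nuclearNorm Z + (∑ i, P.weight (θ i) * θ i) - P.γ * trInner H Z) := by
  obtain ⟨κ, hκ, hlog⟩ := exists_log_one_add_div_le hτ
  have hL : 0 < Real.log (1 + 1 / P.τ) := Real.log_pos (by
    have := one_div_pos.2 hτ
    linarith)
  refine ⟨κ / Real.log (1 + 1 / P.τ), div_pos hκ hL, fun {θ θ' W W' Z Z' H} hf hf' hH => ?_⟩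
  have hsum : ∑ i, Real.log (1 + θ' i / P.τ) / Real.log (1 + 1 / P.τ)
      + κ / Real.log (1 + 1 / P.τ) * ‖θ' - θ‖ ^ 2 ≤
      ∑ i, Real.log (1 + θ i / P.τ) / Real.log (1 + 1 / P.τ)
        + (∑ i, P.weight (θ i) * θ' i - ∑ i, P.weight (θ i) * θ i) := by
    rw [EuclideanSpace.real_norm_sq_eq, Finset.mul_sum, ← Finset.sum_add_distrib,
      ← Finset.sum_sub_distrib, ← Finset.sum_add_distrib]
    refine Finset.sum_le_sum fun i _ => ?_
    have h := hlog (θ i) ⟨hf.nonneg i, hf.le_one i⟩ (θ' i) ⟨hf'.nonneg i, hf'.le_one i⟩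
    have hw : P.weight (θ i) =
        P.τ⁻¹ / (1 + θ i * P.τ⁻¹) / Real.log (1 + 1 / P.τ) := by
      rw [weight, one_div, div_div, mul_comm]
    rw [hw, PiLp.sub_apply]
    have h2 := div_le_div_of_nonneg_right h hL.le
    calc _ = (Real.log (1 + θ' i / P.τ) + κ * (θ' i - θ i) ^ 2) / Real.log (1 + 1 / P.τ) := by
          ring
      _ ≤ _ := h2
      _ = _ := by ring
  have hky := hH Z'
  rw [← trInnerₗ_apply, map_sub, trInnerₗ_apply, trInnerₗ_apply] at hky
  have hky' := mul_le_mul_of_nonneg_left hky hγ.le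
  simp only [F]
  linarith

theorem F_nonneg (hτ : 0 < P.τ) (hγ : 0 < P.γ) {θ : EuclideanSpace ℝ (Fin l)}
    {W : Matrix (Fin n) (Fin n) ℝ} {Z : Matrix (ZIdx n m) (ZIdx n m) ℝ}
    (hf : P.Feasible θ W Z) : 0 ≤ P.F θ W Z := by
  refine add_nonneg (Finset.sum_nonneg fun i _ => div_nonneg ?_ ?_) (mul_nonneg hγ.le ?_)
  · exact Real.log_nonneg (by linarith [div_nonneg (hf.nonneg i) hτ.le])
  · exact Real.log_nonneg (by linarith [one_div_pos.2 hτ])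
  · exact sub_nonneg.2 (kyFanNorm_le_nuclearNorm (card_ZIdx_ge n m) Z)

theorem Generated.feasible {θ : ℕ → EuclideanSpace ℝ (Fin l)}
    {W : ℕ → Matrix (Fin n) (Fin n) ℝ} {Z : ℕ → Matrix (ZIdx n m) (ZIdx n m) ℝ}
    (hgen : P.Generated θ W Z) : ∀ k, P.Feasible (θ k) (W k) (Z k)
  | 0 => hgen.init
  | k + 1 => by
    obtain ⟨_, _, _, _, _, _, _, hf, _⟩ := hgen.step k
    exact hf

theorem Feasible.of_tendsto {α : Type*} {𝒰 : Filter α} [𝒰.NeBot]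
    {θ : α → EuclideanSpace ℝ (Fin l)} {W : α → Matrix (Fin n) (Fin n) ℝ}
    {Z : α → Matrix (ZIdx n m) (ZIdx n m) ℝ} (hf : ∀ k, P.Feasible (θ k) (W k) (Z k))
    {θs : EuclideanSpace ℝ (Fin l)} {Ws : Matrix (Fin n) (Fin n) ℝ}
    {Zs : Matrix (ZIdx n m) (ZIdx n m) ℝ} (hθ : Tendsto θ 𝒰 (𝓝 θs)) (hW : Tendsto W 𝒰 (𝓝 Ws))
    (hZ : Tendsto Z 𝒰 (𝓝 Zs)) : P.Feasible θs Ws Zs := by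
  have hθi : ∀ i, Tendsto (fun k => θ k i) 𝒰 (𝓝 (θs i)) := fun i =>
    ((continuous_apply i).comp (PiLp.continuous_ofLp 2 _)).continuousAt.tendsto.comp hθ
  have hWc : Tendsto (fun k => W k - P.ε • (1 : Matrix (Fin n) (Fin n) ℝ)) 𝒰
      (𝓝 (Ws - P.ε • 1)) := hW.sub_const _
  refine ⟨?_, ?_, fun i => le_of_tendsto' (hθi i) fun k => (hf k).le_one i,
    fun i => ge_of_tendsto' (hθi i) fun k => (hf k).nonneg i,
    ge_of_tendsto' (tendsto_finsetSum _ fun i _ => hθi i) fun k => (hf k).sum_ge⟩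
  · have h := (P.continuous_Zmat.tendsto (θs, Ws)).comp (hθ.prodMk_nhds hW)
    exact tendsto_nhds_unique hZ (h.congr fun k => ((hf k).Z_eq).symm)
  · refine Matrix.PosSemidef.of_dotProduct_mulVec_nonneg ?_ fun x => ?_
    · have h := ((continuous_id.matrix_conjTranspose).tendsto _).comp hWc
      exact tendsto_nhds_unique h (hWc.congr fun k => ((hf k).W_ge.isHermitian).symm)
    · have hc : Continuous fun X : Matrix (Fin n) (Fin n) ℝ => star x ⬝ᵥ X *ᵥ x := by fun_prop
      exact ge_of_tendsto' ((hc.tendsto _).comp hWc) fun k =>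
        (hf k).W_ge.dotProduct_mulVec_nonneg x

end RelaxData

/-! ### Limits of the iterates -/

theorem IsCompact.exists_tendsto_ultrafilter {α X : Type*} [TopologicalSpace X] {K : Set X}
    (hK : IsCompact K) (𝒰 : Ultrafilter α) {u : α → X} (hu : ∀ k, u k ∈ K) :
    ∃ x ∈ K, Tendsto u 𝒰 (𝓝 x) :=
  hK.ultrafilter_le_nhds' (𝒰.map u) (Ultrafilter.mem_map.2 (Filter.univ_mem' hu))

namespace RelaxData

variable {n m l : ℕ} {P : RelaxData n m l}

theorem continuousAt_weight (hτ : 0 < P.τ) {t : ℝ} (ht : 0 ≤ t) : ContinuousAt P.weight t := by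
  have hL : 0 < Real.log (1 + P.τ⁻¹) := Real.log_pos (by linarith [inv_pos.2 hτ])
  have hne : Real.log (1 + P.τ⁻¹) * (1 + t * P.τ⁻¹) ≠ 0 := by positivity
  unfold weight
  fun_prop (disch := assumption)

theorem isCompact_setOf_abs_apply_le (ι κ : Type*) (R : ℝ) :
    IsCompact {X : Matrix ι κ ℝ | ∀ i j, |X i j| ≤ R} := by
  have h : IsCompact (Set.pi Set.univ fun _ : ι => Set.pi Set.univ fun _ : κ => Set.Icc (-R) R) :=
    isCompact_univ_pi fun _ => isCompact_univ_pi fun _ => isCompact_Icc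
  have e : {X : Matrix ι κ ℝ | ∀ i j, |X i j| ≤ R} =
      Set.pi Set.univ fun _ : ι => Set.pi Set.univ fun _ : κ => Set.Icc (-R) R :=
    Set.ext fun X => ⟨fun h i _ j _ => abs_le.1 (h i j),
      fun h i j => abs_le.2 (h i trivial j trivial)⟩
  exact e ▸ h

theorem isCompact_setOf_apply_mem_Icc (l : ℕ) :
    IsCompact {x : EuclideanSpace ℝ (Fin l) | ∀ i, x i ∈ Set.Icc (0 : ℝ) 1} := by
  have h : IsCompact (Set.pi Set.univ fun _ : Fin l => Set.Icc (0 : ℝ) 1) :=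
    isCompact_univ_pi fun _ => isCompact_Icc
  convert h.image (PiLp.continuous_toLp 2 _) using 1
  ext x
  constructor
  · exact fun hx => ⟨fun i => x i, fun i _ => hx i, rfl⟩
  · rintro ⟨y, hy, rfl⟩ i
    exact hy i (Set.mem_univ i)

/-- Limits of the iterates along an ultrafilter are stationary, provided the objective values
settle: the iterates are then asymptotically optimal for their own convex programs, and the
linearizing subgradients have a limit, since they are bounded and the graph of the
subdifferential is closed. -/
theorem Generated.isStationary_of_tendsto (hτ : 0 < P.τ) (hγ : 0 < P.γ)
    {θ : ℕ → EuclideanSpace ℝ (Fin l)} {W : ℕ → Matrix (Fin n) (Fin n) ℝ}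
    {Z : ℕ → Matrix (ZIdx n m) (ZIdx n m) ℝ} (hgen : P.Generated θ W Z)
    (hF : Tendsto (fun k => P.F (θ (k + 1)) (W (k + 1)) (Z (k + 1)) - P.F (θ k) (W k) (Z k))
      atTop (𝓝 0))
    {𝒰 : Ultrafilter ℕ} (h𝒰 : (𝒰 : Filter ℕ) ≤ atTop)
    {θs : EuclideanSpace ℝ (Fin l)} {Ws : Matrix (Fin n) (Fin n) ℝ}
    {Zs : Matrix (ZIdx n m) (ZIdx n m) ℝ} (hθ : Tendsto θ 𝒰 (𝓝 θs)) (hW : Tendsto W 𝒰 (𝓝 Ws))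
    (hZ : Tendsto Z 𝒰 (𝓝 Zs)) : P.IsStationary θs Ws Zs := by
  obtain ⟨κ, hκ, hdesc⟩ := exists_F_le (P := P) hτ hγ
  choose H hsub hbd hfeas hmin using fun k => (hgen.step k).exists_subgradient
  have hfs : P.Feasible θs Ws Zs := Feasible.of_tendsto hgen.feasible hθ hW hZ
  obtain ⟨Hs, -, hH⟩ :=
    (isCompact_setOf_abs_apply_le (ZIdx n m) (ZIdx n m) 1).exists_tendsto_ultrafilter 𝒰 hbd
  have hnuc : Tendsto (fun k => nuclearNorm (Z k)) 𝒰 (𝓝 (nuclearNorm Zs)) :=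
    (continuous_nuclearNorm.tendsto Zs).comp hZ
  have hky : Tendsto (fun k => kyFanNorm (2 * n + m) (Z k)) 𝒰
      (𝓝 (kyFanNorm (2 * n + m) Zs)) :=
    ((continuous_kyFanNorm (card_ZIdx_ge n m)).tendsto Zs).comp hZ
  have htr : ∀ {X : ℕ → Matrix (ZIdx n m) (ZIdx n m) ℝ} {Xs}, Tendsto X 𝒰 (𝓝 Xs) →
      Tendsto (fun k => trInner (H k) (X k)) 𝒰 (𝓝 (trInner Hs Xs)) := fun hX =>
    tendsto_trInner hH hX
  have hθi : ∀ i, Tendsto (fun k => θ k i) 𝒰 (𝓝 (θs i)) := fun i =>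
    ((continuous_apply i).comp (PiLp.continuous_ofLp 2 _)).continuousAt.tendsto.comp hθ
  have hw : ∀ i, Tendsto (fun k => P.weight (θ k i)) 𝒰 (𝓝 (P.weight (θs i))) := fun i =>
    (continuousAt_weight hτ (hfs.nonneg i)).tendsto.comp (hθi i)
  refine isStationary_of_forall_le hγ (H := Hs) hfs (fun Z' => ?_) fun θ' W' Z' hf' => ?_
  · have hdiff : Tendsto (fun k => Z' - Z k) 𝒰 (𝓝 (Z' - Zs)) := hZ.const_sub Z'
    exact le_of_tendsto' (hky.add (htr hdiff)) fun k => hsub k Z'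
  · have hlim1 : Tendsto (fun k => P.γ * nuclearNorm (Z k) + (∑ i, P.weight (θ k i) * θ k i)
        - P.γ * trInner (H k) (Z k)) 𝒰 (𝓝 (P.γ * nuclearNorm Zs
          + (∑ i, P.weight (θs i) * θs i) - P.γ * trInner Hs Zs)) :=
      ((hnuc.const_mul _).add (tendsto_finsetSum _ fun i _ => (hw i).mul (hθi i))).sub
        ((htr hZ).const_mul _)
    have hlim2 : Tendsto (fun k => P.γ * nuclearNorm Z' + (∑ i, P.weight (θ k i) * θ' i)
        - P.γ * trInner (H k) Z' -
          (P.F (θ (k + 1)) (W (k + 1)) (Z (k + 1)) - P.F (θ k) (W k) (Z k))) 𝒰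
        (𝓝 (P.γ * nuclearNorm Z' + (∑ i, P.weight (θs i) * θ' i) - P.γ * trInner Hs Z' - 0)) :=
      ((tendsto_const_nhds.add (tendsto_finsetSum _ fun i _ => (hw i).mul_const _)).sub
        ((htr tendsto_const_nhds).const_mul _)).sub (hF.mono_left h𝒰)
    rw [sub_zero] at hlim2
    refine le_of_tendsto_of_tendsto' hlim1 hlim2 fun k => ?_
    have h1 := hdesc (hgen.feasible k) (hfeas k) (hsub k)
    have h2 := hmin k θ' W' Z' hf'
    have h3 : 0 ≤ κ * ‖θ (k + 1) - θ k‖ ^ 2 := by positivity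
    linarith

end RelaxData

theorem theorem4 {n m l : ℕ} (P : RelaxData n m l)
    (hτ : 0 < P.τ) (hγ : 0 < P.γ) (hε : 0 < P.ε) (hη0 : 0 < P.η) (hη1 : P.η < 1)
    (hμ : ∀ i, ∑ j, (|P.A i j| + ∑ k, |P.Ap k i j|) < P.μ)
    (θ : ℕ → EuclideanSpace ℝ (Fin l)) (W : ℕ → Matrix (Fin n) (Fin n) ℝ)
    (Z : ℕ → Matrix (ZIdx n m) (ZIdx n m) ℝ) (hgen : P.Generated θ W Z) :
    -- (i) the objective is non-increasing
    (∀ k, P.F (θ (k + 1)) (W (k + 1)) (Z (k + 1)) ≤ P.F (θ k) (W k) (Z k)) ∧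
    -- (ii) successive differences tend to zero
    Tendsto (fun k => P.F (θ (k + 1)) (W (k + 1)) (Z (k + 1)) - P.F (θ k) (W k) (Z k))
      atTop (𝓝 0) ∧
    Tendsto (fun k => θ (k + 1) - θ k) atTop (𝓝 0) ∧
    -- the stopping test is met after finitely many iterations, for every threshold
    (∀ ξ : ℝ, 0 < ξ → ∃ k, 1 ≤ k ∧ ‖θ k - θ (k - 1)‖ ≤ ξ) ∧
    -- every limit point of the iterates is a stationary point
    (∀ θs Ws Zs, MapClusterPt (θs, Ws, Zs) atTop (fun k => (θ k, W k, Z k)) →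
      P.IsStationary θs Ws Zs) ∧
    -- if the iterates stay bounded, they approach the set of stationary points
    ((∃ R : ℝ, ∀ k i j, |W k i j| ≤ R) →
      ∀ δ : ℝ, 0 < δ → ∀ᶠ k in atTop, ∃ θs Ws Zs, P.IsStationary θs Ws Zs ∧
        ‖θ k - θs‖ < δ ∧ (∀ i j, |W k i j - Ws i j| < δ) ∧
        (∀ i j, |Z k i j - Zs i j| < δ)) := by
  obtain ⟨κ, hκ, hdesc⟩ := RelaxData.exists_F_le (P := P) hτ hγ
  have hstep : ∀ k, κ * ‖θ (k + 1) - θ k‖ ^ 2 ≤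
      -(P.F (θ (k + 1)) (W (k + 1)) (Z (k + 1)) - P.F (θ k) (W k) (Z k)) := fun k => by
    obtain ⟨H, hsub, -, hf, hmin⟩ := (hgen.step k).exists_subgradient
    have h1 := hdesc (hgen.feasible k) hf hsub
    have h2 := hmin _ _ _ (hgen.feasible k)
    linarith
  have hmono : ∀ k, P.F (θ (k + 1)) (W (k + 1)) (Z (k + 1)) ≤ P.F (θ k) (W k) (Z k) := fun k => by
    have h1 := hstep k
    have h2 : 0 ≤ κ * ‖θ (k + 1) - θ k‖ ^ 2 := by positivity
    linarith
  have hFlim : Tendsto (fun k => P.F (θ (k + 1)) (W (k + 1)) (Z (k + 1))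
      - P.F (θ k) (W k) (Z k)) atTop (𝓝 0) := by
    have h := tendsto_atTop_ciInf (antitone_nat_of_succ_le hmono)
      ⟨0, Set.forall_mem_range.2 fun k => RelaxData.F_nonneg hτ hγ (hgen.feasible k)⟩
    simpa using (h.comp (tendsto_add_atTop_nat 1)).sub h
  have hθlim : Tendsto (fun k => θ (k + 1) - θ k) atTop (𝓝 0) := by
    have h1 : Tendsto (fun k => κ * ‖θ (k + 1) - θ k‖ ^ 2) atTop (𝓝 0) :=
      squeeze_zero (fun k => by positivity) hstep (by simpa using hFlim.neg)
    have h2 : Tendsto (fun k => ‖θ (k + 1) - θ k‖ ^ 2) atTop (𝓝 0) := by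
      simpa [hκ.ne'] using h1.const_mul κ⁻¹
    rw [tendsto_zero_iff_norm_tendsto_zero]
    simpa using h2.sqrt
  refine ⟨hmono, hFlim, hθlim, fun ξ hξ => ?_, fun θs Ws Zs hcl => ?_, ?_⟩
  · obtain ⟨k, hk⟩ := ((tendsto_zero_iff_norm_tendsto_zero.1 hθlim).eventually_lt_const hξ).exists
    exact ⟨k + 1, by omega, hk.le⟩
  · obtain ⟨𝒰, h𝒰, ht⟩ := mapClusterPt_iff_ultrafilter.1 hcl
    rw [nhds_prod_eq, nhds_prod_eq, tendsto_prod_iff', tendsto_prod_iff'] at ht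
    exact hgen.isStationary_of_tendsto hτ hγ hFlim h𝒰 ht.1 ht.2.1 ht.2.2
  · rintro ⟨R, hR⟩ δ hδ
    by_contra hbad
    -- an ultrafilter of late iterates far from all stationary points
    rw [Filter.Eventually, Filter.mem_iff_ultrafilter] at hbad
    push Not at hbad
    obtain ⟨𝒰, h𝒰, hfar⟩ := hbad
    obtain ⟨θs, -, hθ⟩ :=
      (RelaxData.isCompact_setOf_apply_mem_Icc l).exists_tendsto_ultrafilter 𝒰
        (u := θ) fun k i => ⟨(hgen.feasible k).nonneg i, (hgen.feasible k).le_one i⟩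
    obtain ⟨Ws, -, hW⟩ :=
      (RelaxData.isCompact_setOf_abs_apply_le (Fin n) (Fin n) R).exists_tendsto_ultrafilter 𝒰 hR
    have hZ : Tendsto Z 𝒰 (𝓝 (P.Zmat θs Ws)) :=
      ((P.continuous_Zmat.tendsto (θs, Ws)).comp (hθ.prodMk_nhds hW)).congr fun k =>
        ((hgen.feasible k).Z_eq).symm
    have hstat := hgen.isStationary_of_tendsto hτ hγ hFlim h𝒰 hθ hW hZ
    have hentry : ∀ {ι : Type} [Finite ι] {X : ℕ → Matrix ι ι ℝ} {Xs : Matrix ι ι ℝ},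
        Tendsto X 𝒰 (𝓝 Xs) → ∀ᶠ k in (𝒰 : Filter ℕ), ∀ i j, |X k i j - Xs i j| < δ := by
      intro ι _ X Xs hX
      refine eventually_all.2 fun i => eventually_all.2 fun j => ?_
      have h : Tendsto (fun k => X k i j) 𝒰 (𝓝 (Xs i j)) :=
        ((continuous_id.matrix_elem i j).tendsto Xs).comp hX
      simpa [Real.dist_eq] using (Metric.tendsto_nhds.1 h) δ hδ
    have hclose : ∀ᶠ k in (𝒰 : Filter ℕ), ‖θ k - θs‖ < δ := by
      simpa [dist_eq_norm] using (Metric.tendsto_nhds.1 hθ) δ hδ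
    exact hfar <| (hclose.and ((hentry hW).and (hentry hZ))).mono fun k hk =>
      ⟨θs, Ws, _, hstat, hk.1, hk.2.1, hk.2.2⟩
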